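/- A partition of $[n]=\{1,\dots,n\}$ is non-crossing if it has no two distinct blocks $B,C$ with $a,b\in B$, $c,d\in C$ and $a<c<b<d$, and it is an interval partition if each of its blocks consists of consecutive integers. Let $\mathrm{NC}(n)\supseteq\mathrm{Int}(n)$ be the sets of non-crossing and of interval partitions of $[n]$, ordered by $\alpha\le\beta$ iff every block of $\alpha$ is contained in a block of $\beta$; let $0_n$ be the partition into singletons and $1_n$ the partition with a single block. A non-crossing partition is identified with the permutation in $\mathcal S_n$ whose cycles are its blocks, each ordered increasingly. For $\pi\in\mathcal S_n$ let $\|\pi\|$ be the minimal number of transpositions whose product is $\pi$. The Kreweras complement $\alpha^{\mathrm{Kr}}$ of $\alpha\in\mathrm{NC}(n)$ is the largest non-crossing partition of $\{\bar1,\dots,\bar n\}\cong[n]$ such that $\alpha\sqcup\alpha^{\mathrm{Kr}}$ is a non-crossing partition of the ordered set $1<\bar1<2<\bar2<\dots<n<\bar n$; for $S\subseteq \mathrm{NC}(n)$ put $\mathrm{Kr}\,S=\{\alpha^{\mathrm{Kr}}:\alpha\in S\}$. Let $\alpha\wedge_{\mathrm{Kr\,Int}}\beta=\max\{\gamma\in\mathrm{Kr\,Int}(n):\gamma\le\alpha,\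 \gamma\le\beta\}$. The boolean transform $\mathcal F_{\mathrm{boole}}$ sends a power series $\sum_{n\ge1}\kappa_nX^n$ to $\sum_{n\ge1}m_nX^n$, where $$m_n=\sum_{\sigma\in\mathrm{Int}(n)}\ \prod_{c\text{ block of }\sigma}\kappa_{|c|}.$$ Theorem 3.8. Let $L(n)=\mathrm{NC}(n)$ for all $n$, or $L(n)=\mathrm{Int}(n)$ for all $n$, and let $$M(X,Y,A,B)=\sum_{n\ge1}X^n\sum_{\substack{\alpha\in\mathrm{Int}(n)\\ \beta\in L(n)}}Y^{\|\alpha^{-1}\beta\|}A^{\|\alpha\|}B^{\|\beta\|},$$ $$K(X,Y,A,B)=\sum_{n\ge1}X^n\sum_{\substack{\alpha\in\mathrm{Kr\,Int}(n),\ \beta\in\mathrm{Kr}\,L(n)\\ \alpha\wedge_{\mathrm{Kr\,Int}}\beta=0_n}}Y^{\|\alpha^{-1}\beta\|}A^{\|\alpha^{-1}1_n\|}B^{\|\beta^{-1}1_n\|}.$$ Then $\mathcal F_{\mathrm{boole}}$, applied to power series in $X$, sends $K(X,Y,A,B)$ to $M(X,Y,A,B)$. -/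

import Mathlib

open scoped PowerSeries

namespace Meander

noncomputable section

/-- Set partitions of `{0, …, n-1}` (standing for `[n] = {1, …, n}`). The order `≤` on them is
Mathlib's: `α ≤ β` iff every block of `α` is contained in a block of `β`; `⊥ = 0_n` is the partition
into singletons and, for `n ≥ 1`, `⊤ = 1_n` is the partition with one block. -/
abbrev SetPartition (n : ℕ) : Type := Finpartition (Finset.univ : Finset (Fin n))

/-- A family of blocks in a linearly ordered set is non-crossing if there are no distinct blocks
`B, C` with `a, b ∈ B`, `c, d ∈ C` and `a < c < b < d`. -/
def NonCrossing {ι : Type*} [LinearOrder ι] (blocks : Finset (Finset ι)) : Prop :=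
  ∀ B ∈ blocks, ∀ C ∈ blocks, B ≠ C →
    ¬ ∃ a ∈ B, ∃ b ∈ B, ∃ c ∈ C, ∃ d ∈ C, a < c ∧ c < b ∧ b < d

open Classical in
/-- `NC(n)`: the non-crossing partitions of `[n]`. -/
def NC (n : ℕ) : Finset (SetPartition n) :=
  Finset.univ.filter fun α => NonCrossing α.parts

open Classical in
/-- `Int(n)`: the interval partitions of `[n]`, all of whose blocks consist of consecutive
integers. -/
def Intv (n : ℕ) : Finset (SetPartition n) :=
  Finset.univ.filter fun α => ∀ B ∈ α.parts, (B : Set (Fin n)).OrdConnected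

/-- The blocks of `α ⊔ σ` on the doubled set `1 < 1̄ < 2 < 2̄ < ⋯ < n < n̄`, where `α` is placed on
the points `i = (i, false)` and `σ` on the points `ī = (i, true)`. -/
def interleave {n : ℕ} (α σ : SetPartition n) : Finset (Finset (Fin n ×ₗ Bool)) :=
  α.parts.image (fun B => B.image fun i => toLex (i, false)) ∪
    σ.parts.image (fun B => B.image fun i => toLex (i, true))

/-- `σ` is the Kreweras complement of `α`: the largest non-crossing partition such that `α ⊔ σ` is
non-crossing on the doubled set. -/
def IsKrewerasComplement {n : ℕ} (α σ : SetPartition n) : Prop :=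
  IsGreatest {τ : SetPartition n | τ ∈ NC n ∧ NonCrossing (interleave α τ)} σ

open Classical in
/-- `Kr S`: the set of Kreweras complements of the elements of `S`. -/
def Kr {n : ℕ} (S : Finset (SetPartition n)) : Finset (SetPartition n) :=
  Finset.univ.filter fun σ => ∃ α ∈ S, IsKrewerasComplement α σ

/-- `γ = α ∧_{Kr Int} β`: the largest element of `Kr Int(n)` which is below both `α` and `β`. -/
def IsKrIntMeet {n : ℕ} (α β γ : SetPartition n) : Prop :=
  IsGreatest {τ : SetPartition n | τ ∈ Kr (Intv n) ∧ τ ≤ α ∧ τ ≤ β} γ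

/-- The cycle that permutes the elements of a block in increasing order (and fixes all other
points). -/
def blockCycle {n : ℕ} (B : Finset (Fin n)) : Equiv.Perm (Fin n) :=
  (B.sort (· ≤ ·)).formPerm

theorem blockCycle_disjoint {n : ℕ} {B C : Finset (Fin n)} (h : Disjoint B C) :
    (blockCycle B).Disjoint (blockCycle C) := by
  intro x
  by_cases hx : x ∈ B
  · right
    exact List.formPerm_apply_of_notMem (by
      rw [Finset.mem_sort]; exact Finset.disjoint_left.mp h hx)
  · left
    exact List.formPerm_apply_of_notMem (by rwa [Finset.mem_sort])

/-- The permutation associated with a partition: the product of the cycles given by its blocks. -/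
def toPerm {n : ℕ} (α : SetPartition n) : Equiv.Perm (Fin n) :=
  α.parts.noncommProd blockCycle fun _ hB _ hC hne =>
    (blockCycle_disjoint (α.disjoint hB hC hne)).commute

/-- The length of a permutation: the minimal number of transpositions whose product it is. -/
def permLength {n : ℕ} (π : Equiv.Perm (Fin n)) : ℕ :=
  sInf {m : ℕ | ∃ l : List (Equiv.Perm (Fin n)),
    l.length = m ∧ (∀ τ ∈ l, τ.IsSwap) ∧ l.prod = π}

/-- The generating series `∑_{n ≥ 1} m_n X^n`. -/
def genSeries {R : Type*} [CommSemiring R] (m : ℕ → R) : R⟦X⟧ :=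
  PowerSeries.mk fun n => if n = 0 then 0 else m n

/-- The boolean transform of sequences:
`m_n = ∑_{σ ∈ Int(n)} ∏_{c block of σ} κ_{|c|}`. Only indices `n ≥ 1` are meaningful; no block is
empty, so `κ 0` is never used. -/
def booleSeq {R : Type*} [CommSemiring R] (κ : ℕ → R) (n : ℕ) : R :=
  ∑ σ ∈ Intv n, ∏ c ∈ σ.parts, κ c.card

/-- The boolean transform of generating series. -/
def boole {R : Type*} [CommSemiring R] (K : R⟦X⟧) : R⟦X⟧ :=
  genSeries (booleSeq fun n => PowerSeries.coeff n K)

/-- `m_n = ∑_{α ∈ Int(n), β ∈ L(n)} Y^‖α⁻¹β‖ A^‖α‖ B^‖β‖`. -/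
def moment {R : Type*} [CommSemiring R] (L : (n : ℕ) → Finset (SetPartition n)) (Y A B : R)
    (n : ℕ) : R :=
  ∑ α ∈ Intv n, ∑ β ∈ L n,
    Y ^ permLength ((toPerm α)⁻¹ * toPerm β) * A ^ permLength (toPerm α) * B ^ permLength (toPerm β)

open Classical in
/-- `κ_n = ∑ Y^‖α⁻¹β‖ A^‖α⁻¹1_n‖ B^‖β⁻¹1_n‖`, the sum being over `α ∈ Kr Int(n)` and `β ∈ Kr L(n)`
with `α ∧_{Kr Int} β = 0_n`. -/
def cumulant {R : Type*} [CommSemiring R] (L : (n : ℕ) → Finset (SetPartition n)) (Y A B : R)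
    (n : ℕ) : R :=
  ∑ α ∈ Kr (Intv n), ∑ β ∈ (Kr (L n)).filter fun β => IsKrIntMeet α β ⊥,
    Y ^ permLength ((toPerm α)⁻¹ * toPerm β) *
      A ^ permLength ((toPerm α)⁻¹ * toPerm (⊤ : SetPartition n)) *
      B ^ permLength ((toPerm β)⁻¹ * toPerm (⊤ : SetPartition n))

/-- `M(X,Y,A,B)`, as a power series in `X`. -/
def momentSeries {R : Type*} [CommSemiring R] (L : (n : ℕ) → Finset (SetPartition n))
    (Y A B : R) : R⟦X⟧ :=
  genSeries (moment L Y A B)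

/-- `K(X,Y,A,B)`, as a power series in `X`. -/
def cumulantSeries {R : Type*} [CommSemiring R] (L : (n : ℕ) → Finset (SetPartition n))
    (Y A B : R) : R⟦X⟧ :=
  genSeries (cumulant L Y A B)

end

end Meander

/-! Call `i` a cut of a partition if no block meets both the first `i` points and the rest.
Concatenation makes a pair `(α, β)` split uniquely at its smallest positive common cut `k` into a
pair on `k` points without proper common cut and an arbitrary pair on the remaining points. The
weight `Y^‖α⁻¹β‖ A^‖α‖ B^‖β‖` is multiplicative under this splitting, so the moments satisfy `m_n =
∑_{k ≥ 1} κ_k m_{n-k}` with `m_0 = 1`, where `κ_k` sums the weights of the irreducible pairs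
(`pairSum_eq_sum`). The boolean transform obeys the same recursion: it is the case where the second
partition is always `⊥`, which imposes no condition on cuts.

It remains to recognise `κ_n` as the coefficient of `K`. As permutations, `α^Kr = α⁻¹ 1_n`
(`toPerm_krew`), so by conjugation and inversion the weight of `(α^Kr, β^Kr)` in `K` is the weight
of `(α, β)` in `M` (`permLength_krew_inv_mul_krew`, `permLength_krew_inv_mul_top`). Since the
complement reverses the order, a common cut of `α` and `β` gives a nontrivial element of `Kr Int(n)`
below both complements, and every such element comes from a common cut (`isKrIntMeet_bot_iff`).

The properties of the length come from linear algebra: `‖π‖` is the dimension of the span of the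
vectors `e_{π i} - e_i` (`permLength_eq_finrank`). -/

namespace Meander

/-! ### Partitions as equivalence relations -/

/-- `x` and `y` lie in the same block of `α`. -/
def Rel {n : ℕ} (α : SetPartition n) (x y : Fin n) : Prop := α.part x = α.part y

variable {n : ℕ} {α β : SetPartition n} {x y z : Fin n}

theorem Rel.refl (α : SetPartition n) (x : Fin n) : Rel α x x := rfl

theorem Rel.symm (h : Rel α x y) : Rel α y x := Eq.symm h

theorem Rel.trans (h : Rel α x y) (h' : Rel α y z) : Rel α x z := Eq.trans h h'

theorem mem_part_iff : y ∈ α.part x ↔ Rel α x y := by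
  rw [Finpartition.mem_part_iff_part_eq_part _ (Finset.mem_univ _) (Finset.mem_univ _), Rel, eq_comm]

theorem rel_iff_exists : Rel α x y ↔ ∃ B ∈ α.parts, x ∈ B ∧ y ∈ B := by
  rw [← mem_part_iff, Finpartition.mem_part_iff_exists]
  simp only [and_comm]

theorem rel_of_mem {B : Finset (Fin n)} (hB : B ∈ α.parts) (hx : x ∈ B) (hy : y ∈ B) :
    Rel α x y := rel_iff_exists.2 ⟨B, hB, hx, hy⟩

theorem mem_of_rel {B : Finset (Fin n)} (hB : B ∈ α.parts) (hx : x ∈ B) (h : Rel α x y) :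
    y ∈ B := by
  rw [← Finpartition.part_eq_of_mem _ hB hx]
  exact mem_part_iff.2 h

theorem mem_parts_iff {B : Finset (Fin n)} : B ∈ α.parts ↔ ∃ x, α.part x = B := by
  constructor
  · intro h
    obtain ⟨x, hx⟩ := α.nonempty_of_mem_parts h
    exact ⟨x, Finpartition.part_eq_of_mem _ h hx⟩
  · rintro ⟨x, rfl⟩
    simp

theorem le_iff_rel : α ≤ β ↔ ∀ x y, Rel α x y → Rel β x y := by
  constructor
  · intro h x y hxy
    obtain ⟨C, hC, hBC⟩ := h (show α.part x ∈ α.parts by simp)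
    exact rel_of_mem hC (hBC (mem_part_iff.2 (Rel.refl _ _))) (hBC (mem_part_iff.2 hxy))
  · intro h B hB
    obtain ⟨x, rfl⟩ := mem_parts_iff.1 hB
    exact ⟨β.part x, by simp, fun y hy => mem_part_iff.2 (h _ _ (mem_part_iff.1 hy))⟩

theorem ext_rel (h : ∀ x y, Rel α x y ↔ Rel β x y) : α = β :=
  le_antisymm (le_iff_rel.2 fun x y => (h x y).1) (le_iff_rel.2 fun x y => (h x y).2)

open Classical in
/-- The partition whose blocks are the fibres of `f`. -/
noncomputable def kerPartition {ι : Type*} (f : Fin n → ι) : SetPartition n :=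
  Finpartition.ofSetoid (Setoid.ker f)

@[simp]
theorem rel_kerPartition {ι : Type*} {f : Fin n → ι} : Rel (kerPartition f) x y ↔ f x = f y := by
  classical
  rw [← mem_part_iff, kerPartition, Finpartition.mem_part_ofSetoid_iff_rel, Setoid.ker_def]

theorem rel_bot : Rel (⊥ : SetPartition n) x y ↔ x = y := by
  constructor
  · intro h
    have h' : (⊥ : SetPartition n) ≤ kerPartition id := bot_le
    simpa using le_iff_rel.1 h' _ _ h
  · rintro rfl
    rfl

theorem rel_top : Rel (⊤ : SetPartition n) x y :=
  le_iff_rel.1 (le_top : kerPartition (fun _ => ()) ≤ ⊤) _ _ (by simp)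

theorem mem_Intv : α ∈ Intv n ↔ ∀ x y z, x ≤ y → y ≤ z → Rel α x z → Rel α x y := by
  simp only [Intv, Finset.mem_filter, Finset.mem_univ, true_and]
  constructor
  · intro h x y z hxy hyz hxz
    have hm := (h (α.part x) (by simp)).out (mem_part_iff.2 (Rel.refl _ _)) (mem_part_iff.2 hxz)
      ⟨hxy, hyz⟩
    exact mem_part_iff.1 hm
  · intro h B hB
    refine ⟨fun x hx z hz y hy => ?_⟩
    exact mem_of_rel hB hx (h x y z hy.1 hy.2 (rel_of_mem hB hx hz))

theorem mem_NC : α ∈ NC n ↔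
    ∀ a c b d, a < c → c < b → b < d → Rel α a b → Rel α c d → Rel α a c := by
  simp only [NC, Finset.mem_filter, Finset.mem_univ, true_and]
  constructor
  · intro h a c b d h1 h2 h3 hab hcd
    by_contra hac
    exact h (α.part a) (by simp) (α.part c) (by simp) hac ⟨a, mem_part_iff.2 (Rel.refl _ _), b,
      mem_part_iff.2 hab, c, mem_part_iff.2 (Rel.refl _ _), d, mem_part_iff.2 hcd, h1, h2, h3⟩
  · rintro h B hB C hC hne ⟨a, ha, b, hb, c, hc, d, hd, h1, h2, h3⟩
    have := h a c b d h1 h2 h3 (rel_of_mem hB ha hb) (rel_of_mem hC hc hd)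
    exact hne (α.eq_of_mem_parts hB hC (mem_of_rel hB ha this) hc)

theorem Intv_subset_NC : Intv n ⊆ NC n := by
  intro α h
  rw [mem_Intv] at h
  exact mem_NC.2 fun a c b d h1 h2 _ hab _ => h a c b h1.le h2.le hab

/-! ### The permutation of a partition -/

theorem toPerm_apply (α : SetPartition n) (x : Fin n) : toPerm α x = blockCycle (α.part x) x := by
  have hx : α.part x ∈ α.parts := by simp
  have hc : (α.parts : Set (Finset (Fin n))).Pairwise (Function.onFun Commute blockCycle) :=
    fun _ hB _ hC hne => (blockCycle_disjoint (α.disjoint hB hC hne)).commute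
  have h : toPerm α = α.parts.noncommProd blockCycle hc := rfl
  rw [h, ← Finset.mul_noncommProd_erase _ hx, Equiv.Perm.mul_apply]
  congr 1
  refine Finset.noncommProd_induction _ _ _ (fun g : Equiv.Perm (Fin n) => g x = x) ?_ rfl ?_
  · intro f g hf hg
    rw [Equiv.Perm.mul_apply, hg, hf]
  · intro B hB
    rw [Finset.mem_erase] at hB
    refine List.formPerm_apply_of_notMem fun hxB => hB.1 ?_
    rw [Finset.mem_sort] at hxB
    exact (Finpartition.part_eq_of_mem _ hB.2 hxB).symm

theorem exists_sort_getElem (α : SetPartition n) (x : Fin n) :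
    ∃ (l : List (Fin n)) (i : ℕ) (hi : i < l.length), l.SortedLT ∧ l[i] = x ∧
      (∀ y, y ∈ l ↔ Rel α x y) ∧
      toPerm α x = l[(i + 1) % l.length]'(Nat.mod_lt _ (i.zero_le.trans_lt hi)) := by
  have hx : x ∈ (α.part x).sort (· ≤ ·) := by
    rw [Finset.mem_sort, mem_part_iff]; rfl
  obtain ⟨i, hi, hix⟩ := List.getElem_of_mem hx
  refine ⟨(α.part x).sort (· ≤ ·), i, hi, Finset.sortedLT_sort _, hix, ?_, ?_⟩
  · intro y
    rw [Finset.mem_sort, mem_part_iff]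
  · rw [toPerm_apply, blockCycle, ← List.formPerm_apply_getElem _ (Finset.sort_nodup _ _) i hi, hix]

theorem rel_toPerm (α : SetPartition n) (x : Fin n) : Rel α x (toPerm α x) := by
  obtain ⟨l, i, hi, -, -, hl, h⟩ := exists_sort_getElem α x
  rw [h, ← hl]
  exact List.getElem_mem _

/-- Together with `toPerm_le` this describes `toPerm` through the order alone: a point that is not
the maximum of its block moves to the next larger element of the block, and the maximum wraps around
to the minimum. The sorted lists are not needed afterwards. -/
theorem toPerm_of_lt (h : x < y) (hxy : Rel α x y) : x < toPerm α x ∧ toPerm α x ≤ y := by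
  obtain ⟨l, i, hi, hs, hix, hl, hp⟩ := exists_sort_getElem α x
  obtain ⟨j, hj, hjy⟩ := List.getElem_of_mem ((hl y).2 hxy)
  have hij : i < j := by
    rw [← hix, ← hjy] at h
    exact hs.getElem_lt_getElem_iff.1 h
  simp only [Nat.mod_eq_of_lt (show i + 1 < l.length by omega)] at hp
  rw [hp]
  constructor
  · conv_lhs => rw [← hix]
    exact hs.getElem_lt_getElem_iff.2 (by omega)
  · rw [← hjy]
    exact hs.getElem_le_getElem_iff.2 (by omega)

theorem toPerm_le (h : toPerm α x ≤ x) (hxy : Rel α x y) : toPerm α x ≤ y ∧ y ≤ x := by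
  have hyx : y ≤ x := by
    by_contra! hlt
    exact absurd (toPerm_of_lt hlt hxy).1 h.not_gt
  refine ⟨?_, hyx⟩
  obtain ⟨l, i, hi, hs, hix, hl, hp⟩ := exists_sort_getElem α x
  obtain ⟨j, hj, hjy⟩ := List.getElem_of_mem ((hl y).2 hxy)
  by_cases hi' : i + 1 < l.length
  · have h1 : l[i] < l[i+1] := hs.getElem_lt_getElem_iff.2 (by omega)
    simp only [Nat.mod_eq_of_lt hi'] at hp
    rw [hix, ← hp] at h1
    exact absurd h1 h.not_gt
  · have : i + 1 = l.length := by omega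
    simp only [this, Nat.mod_self] at hp
    rw [hp, ← hjy]
    exact hs.getElem_le_getElem_iff.2 (by omega)

/-- Nothing has to be checked at the maximum of a block: `f` is injective and preserves the block,
so only one value is left there. -/
theorem eq_toPerm {f : Equiv.Perm (Fin n)} (h1 : ∀ x, Rel α x (f x))
    (h2 : ∀ x y, x < y → Rel α x y → x < f x ∧ f x ≤ y) : f = toPerm α := by
  have key : ∀ x y, x < y → Rel α x y → f x = toPerm α x := by
    intro x y hxy h
    have ha := h2 x y hxy h
    have hb := toPerm_of_lt hxy h
    exact le_antisymm (h2 x _ hb.1 (rel_toPerm α x)).2 (toPerm_of_lt ha.1 (h1 x)).2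
  ext1 x
  obtain ⟨y, hy⟩ := (toPerm α).surjective (f x)
  have hxy : Rel α x y := (h1 x).trans (hy ▸ (rel_toPerm α y).symm)
  rcases lt_trichotomy x y with hlt | rfl | hlt
  · exact key x y hlt hxy
  · exact hy.symm
  · rw [← key y x hlt hxy.symm] at hy
    exact absurd (f.injective hy) hlt.ne

/-- If `x < y` are related, then `toPerm α x` lies in the same block, strictly closer to `y`.
Iterating recovers the whole relation from the permutation, by induction on the distance. -/
theorem toPerm_injective : Function.Injective (toPerm (n := n)) := by
  have key : ∀ α β : SetPartition n, toPerm α = toPerm β →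
      ∀ (d : ℕ) (x y : Fin n), (y : ℕ) = x + d → Rel α x y → Rel β x y := by
    intro α β h d
    induction d using Nat.strong_induction_on with
    | _ d ih =>
      intro x y hd hxy
      rcases (show x ≤ y from Fin.le_def.2 (by omega)).eq_or_lt with rfl | hlt
      · rfl
      · have ht := toPerm_of_lt hlt hxy
        have h1 := ht.1
        have h2 := ht.2
        rw [Fin.lt_def] at h1
        rw [Fin.le_def] at h2
        refine (h ▸ rel_toPerm β x : Rel β x (toPerm α x)).trans
          (ih ((y : ℕ) - toPerm α x) (by omega) _ _ (by omega) ((rel_toPerm α x).symm.trans hxy))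
  have key' : ∀ α β : SetPartition n, toPerm α = toPerm β → α ≤ β := by
    intro α β h
    refine le_iff_rel.2 fun x y hxy => ?_
    rcases le_total x y with hle | hle
    · exact key α β h (y - x) x y (by rw [Fin.le_def] at hle; omega) hxy
    · exact (key α β h (x - y) y x (by rw [Fin.le_def] at hle; omega) hxy.symm).symm
  exact fun α β h => le_antisymm (key' α β h) (key' β α h.symm)

end Meander

namespace Meander

/-! ### The length of a permutation as a dimension -/

section PermLength

open Module

variable {ι κ : Type*}

/-- The span of the vectors `e_{π i} - e_i`. -/
noncomputable def moveSpan (π : Equiv.Perm ι) : Submodule ℚ (ι →₀ ℚ) :=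
  Submodule.span ℚ (Set.range fun i => Finsupp.single (π i) 1 - Finsupp.single i 1)

theorem mem_moveSpan (π : Equiv.Perm ι) (i : ι) :
    Finsupp.single (π i) 1 - Finsupp.single i 1 ∈ moveSpan π :=
  Submodule.subset_span ⟨i, rfl⟩

theorem moveSpan_le {π : Equiv.Perm ι} {V : Submodule ℚ (ι →₀ ℚ)} :
    moveSpan π ≤ V ↔ ∀ i, Finsupp.single (π i) 1 - Finsupp.single i 1 ∈ V := by
  rw [moveSpan, Submodule.span_le, Set.range_subset_iff]
  rfl

theorem moveSpan_mul_le (π ρ : Equiv.Perm ι) : moveSpan (π * ρ) ≤ moveSpan π ⊔ moveSpan ρ := by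
  rw [moveSpan_le]
  intro i
  rw [show (Finsupp.single ((π * ρ) i) 1 - Finsupp.single i 1 : ι →₀ ℚ) =
    (Finsupp.single (π (ρ i)) 1 - Finsupp.single (ρ i) 1) +
      (Finsupp.single (ρ i) 1 - Finsupp.single i 1) by simp]
  exact add_mem (Submodule.mem_sup_left (mem_moveSpan π _))
    (Submodule.mem_sup_right (mem_moveSpan ρ _))

theorem moveSpan_one : moveSpan (1 : Equiv.Perm ι) = ⊥ := by
  rw [eq_bot_iff, moveSpan_le]
  simp

theorem moveSpan_swap_le [DecidableEq ι] (x y : ι) :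
    moveSpan (Equiv.swap x y) ≤ Submodule.span ℚ {Finsupp.single y 1 - Finsupp.single x 1} := by
  rw [moveSpan_le]
  intro i
  rcases eq_or_ne i x with rfl | hx
  · rw [Equiv.swap_apply_left]
    exact Submodule.mem_span_singleton_self _
  rcases eq_or_ne i y with rfl | hy
  · rw [Equiv.swap_apply_right, ← Submodule.neg_mem_iff, neg_sub]
    exact Submodule.mem_span_singleton_self _
  · simp [Equiv.swap_apply_of_ne_of_ne hx hy]

theorem moveSpan_inv (π : Equiv.Perm ι) : moveSpan π⁻¹ = moveSpan π := by
  have key : ∀ π : Equiv.Perm ι, moveSpan π⁻¹ ≤ moveSpan π := by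
    intro π
    rw [moveSpan_le]
    intro i
    have := neg_mem (mem_moveSpan π (π⁻¹ i))
    simpa using this
  exact le_antisymm (key π) (by simpa using key π⁻¹)

theorem map_moveSpan {π : Equiv.Perm ι} {ρ : Equiv.Perm κ} (f : ι → κ)
    (h : ∀ i, ρ (f i) = f (π i)) :
    (moveSpan π).map (Finsupp.lmapDomain ℚ ℚ f) = Submodule.span ℚ
      (Set.range fun i => Finsupp.single (ρ (f i)) 1 - Finsupp.single (f i) 1) := by
  rw [moveSpan, Submodule.map_span, ← Set.range_comp]
  congr 1
  ext
  simp [Finsupp.mapDomain_single, h, Finsupp.mapDomain_sub]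

theorem finrank_map_moveSpan (π : Equiv.Perm ι) {f : ι → κ} (hf : Function.Injective f) :
    finrank ℚ ((moveSpan π).map (Finsupp.lmapDomain ℚ ℚ f)) = finrank ℚ (moveSpan π) :=
  (Submodule.equivMapOfInjective _ (Finsupp.mapDomain_injective hf) _).finrank_eq.symm

variable [Finite ι]

/-- Each transposition enlarges the span by at most one dimension. -/
theorem finrank_moveSpan_prod_le [DecidableEq ι] (l : List (Equiv.Perm ι))
    (hl : ∀ τ ∈ l, τ.IsSwap) : finrank ℚ (moveSpan l.prod) ≤ l.length := by
  induction l with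
  | nil => rw [List.prod_nil, moveSpan_one, finrank_bot]; exact Nat.zero_le _
  | cons τ l ih =>
    have h1 := ih fun τ h => hl τ (List.mem_cons_of_mem _ h)
    obtain ⟨x, y, -, rfl⟩ := hl τ List.mem_cons_self
    have h2 : finrank ℚ (moveSpan (Equiv.swap x y)) ≤ 1 :=
      (Submodule.finrank_mono (moveSpan_swap_le x y)).trans
        ((finrank_span_le_card _).trans (by simp))
    rw [List.prod_cons, List.length_cons]
    have h3 := Submodule.finrank_mono (moveSpan_mul_le (Equiv.swap x y) l.prod)
    have h4 := Submodule.finrank_add_le_finrank_add_finrank (moveSpan (Equiv.swap x y))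
      (moveSpan l.prod)
    omega

/-- Multiplying by the transposition of `i` and `π i` makes the moved point `i` fixed and keeps the
span inside the old one. The inclusion is strict, so induction on the dimension applies. -/
theorem exists_swaps_length_le [DecidableEq ι] (π : Equiv.Perm ι) :
    ∃ l : List (Equiv.Perm ι), l.length ≤ finrank ℚ (moveSpan π) ∧ (∀ τ ∈ l, τ.IsSwap) ∧
      l.prod = π := by
  induction hd : finrank ℚ (moveSpan π) using Nat.strong_induction_on generalizing π with
  | _ d ih =>
    by_cases hπ : π = 1
    · exact ⟨[], by simp, by simp, by simp [hπ]⟩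
    obtain ⟨i, hi⟩ : ∃ i, π i ≠ i := by
      by_contra! h
      exact hπ (Equiv.ext h)
    set ρ := Equiv.swap i (π i) * π with hρ
    have hρi : ρ i = i := by simp [hρ]
    have hle : moveSpan ρ ≤ moveSpan π := by
      refine (moveSpan_mul_le _ _).trans (sup_le ((moveSpan_swap_le _ _).trans ?_) le_rfl)
      rw [Submodule.span_singleton_le_iff_mem]
      exact mem_moveSpan π i
    have hlt : moveSpan ρ < moveSpan π := by
      refine lt_of_le_of_ne hle fun heq => ?_
      -- Since `ρ` fixes `i`, all its vectors vanish at coordinate `i`, whereas `e_{π i} - e_i` does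
      -- not.
      have hker : moveSpan ρ ≤ LinearMap.ker (Finsupp.lapply i : (ι →₀ ℚ) →ₗ[ℚ] ℚ) := by
        rw [moveSpan_le]
        intro j
        rcases eq_or_ne j i with rfl | hj
        · simp [hρi]
        · have : ρ j ≠ i := fun h => hj (ρ.injective (h.trans hρi.symm))
          simp [hj, this]
      have := hker (heq ▸ mem_moveSpan π i)
      simp [hi] at this
    obtain ⟨l, hl, hs, hp⟩ := ih _ (hd ▸ Submodule.finrank_lt_finrank_of_lt hlt) ρ rfl
    refine ⟨Equiv.swap i (π i) :: l, ?_, ?_, ?_⟩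
    · have := Submodule.finrank_lt_finrank_of_lt hlt
      rw [List.length_cons]
      omega
    · intro τ hτ
      rcases List.mem_cons.1 hτ with rfl | h
      · exact ⟨i, π i, hi.symm, rfl⟩
      · exact hs τ h
    · rw [List.prod_cons, hp, hρ, Equiv.swap_mul_self_mul]

theorem permLength_eq_finrank {n : ℕ} (π : Equiv.Perm (Fin n)) :
    permLength π = finrank ℚ (moveSpan π) := by
  apply le_antisymm
  · obtain ⟨l, hl, hs, hp⟩ := exists_swaps_length_le π
    have h : permLength π ≤ l.length := Nat.sInf_le ⟨l, rfl, hs, hp⟩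
    exact h.trans hl
  · obtain ⟨l, hl, hs, hp⟩ := exists_swaps_length_le π
    refine le_csInf ⟨_, l, rfl, hs, hp⟩ ?_
    rintro m ⟨l, rfl, hs, rfl⟩
    exact finrank_moveSpan_prod_le l hs

theorem permLength_inv {n : ℕ} (π : Equiv.Perm (Fin n)) : permLength π⁻¹ = permLength π := by
  rw [permLength_eq_finrank, permLength_eq_finrank, moveSpan_inv]

theorem permLength_conj {n : ℕ} (g π : Equiv.Perm (Fin n)) :
    permLength (g * π * g⁻¹) = permLength π := by
  have key : (moveSpan π).map (Finsupp.lmapDomain ℚ ℚ g) = moveSpan (g * π * g⁻¹) := by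
    rw [map_moveSpan (ρ := g * π * g⁻¹) g (by simp)]
    exact congrArg _ (g.surjective.range_comp
      fun j => (Finsupp.single ((g * π * g⁻¹) j) 1 - Finsupp.single j 1 : Fin n →₀ ℚ))
  rw [permLength_eq_finrank, permLength_eq_finrank, ← key,
    finrank_map_moveSpan π g.injective]

/-- The spans of the two pieces are supported on disjoint sets of coordinates, so their sum is
direct and dimensions add. -/
theorem permLength_eq_add {k m n : ℕ} {p : Equiv.Perm (Fin k)} {q : Equiv.Perm (Fin m)}
    {r : Equiv.Perm (Fin n)} (f : Fin k → Fin n) (g : Fin m → Fin n)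
    (hf : Function.Injective f) (hg : Function.Injective g) (hfg : ∀ i j, f i ≠ g j)
    (hcover : ∀ x, (∃ i, f i = x) ∨ ∃ j, g j = x)
    (hp : ∀ i, r (f i) = f (p i)) (hq : ∀ j, r (g j) = g (q j)) :
    permLength r = permLength p + permLength q := by
  have hsup : moveSpan r = (moveSpan p).map (Finsupp.lmapDomain ℚ ℚ f) ⊔
      (moveSpan q).map (Finsupp.lmapDomain ℚ ℚ g) := by
    rw [map_moveSpan (ρ := r) f hp, map_moveSpan (ρ := r) g hq, ← Submodule.span_union, moveSpan]
    congr 1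
    ext v
    constructor
    · rintro ⟨x, rfl⟩
      rcases hcover x with ⟨i, rfl⟩ | ⟨j, rfl⟩
      · exact Or.inl ⟨i, rfl⟩
      · exact Or.inr ⟨j, rfl⟩
    · rintro (⟨i, rfl⟩ | ⟨j, rfl⟩)
      · exact ⟨f i, rfl⟩
      · exact ⟨g j, rfl⟩
  have hinf : (moveSpan p).map (Finsupp.lmapDomain ℚ ℚ f) ⊓
      (moveSpan q).map (Finsupp.lmapDomain ℚ ℚ g) = ⊥ := by
    rw [Submodule.eq_bot_iff]
    rintro v ⟨⟨u, -, rfl⟩, ⟨w, -, hw⟩⟩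
    ext x
    rcases hcover x with ⟨i, rfl⟩ | ⟨j, rfl⟩
    · rw [← hw]
      exact Finsupp.mapDomain_of_notMem_range _ _ (by rintro ⟨j, hj⟩; exact hfg i j hj.symm)
    · exact Finsupp.mapDomain_of_notMem_range _ _ (by rintro ⟨i, hi⟩; exact hfg i j hi)
  have h := Submodule.finrank_sup_add_finrank_inf_eq ((moveSpan p).map (Finsupp.lmapDomain ℚ ℚ f))
    ((moveSpan q).map (Finsupp.lmapDomain ℚ ℚ g))
  rw [hinf, finrank_bot, add_zero, ← hsup] at h
  rw [permLength_eq_finrank, permLength_eq_finrank, permLength_eq_finrank, h,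
    finrank_map_moveSpan p hf, finrank_map_moveSpan q hg]

end PermLength

end Meander

/-! ### The Kreweras complement -/

namespace Meander

variable {n : ℕ} {α β : SetPartition n}

/-- The pairs of related points `x ≤ i < y`: the arcs of `α` passing over the gap after `i`. -/
def arcs (α : SetPartition n) (i : Fin n) : Set (Fin n × Fin n) :=
  {p | Rel α p.1 p.2 ∧ p.1 ≤ i ∧ i < p.2}

/-- The Kreweras complement: two gaps are related iff the same arcs pass over them. -/
noncomputable def krew (α : SetPartition n) : SetPartition n := kerPartition (arcs α)

theorem rel_krew {i j : Fin n} : Rel (krew α) i j ↔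
    ∀ x y, Rel α x y → (x ≤ i ∧ i < y ↔ x ≤ j ∧ j < y) := by
  rw [krew, rel_kerPartition, Set.ext_iff, Prod.forall]
  simp only [arcs, Set.mem_ofPred_eq, and_congr_right_iff]

theorem krew_antitone : Antitone (krew (n := n)) := by
  intro α β h
  rw [le_iff_rel] at h ⊢
  intro i j hij
  rw [rel_krew] at hij ⊢
  exact fun x y hxy => hij x y (h x y hxy)

/-- The gaps under a given arc form an interval. When `a < c < b < d`, an interval containing both
or neither of `a, b`, and both or neither of `c, d`, cannot separate `a` from `c`. -/
theorem krew_mem_NC (α : SetPartition n) : krew α ∈ NC n := by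
  rw [mem_NC]
  intro a c b d h1 h2 h3 hab hcd
  rw [rel_krew] at *
  intro x y hxy
  have hab := hab x y hxy
  have hcd := hcd x y hxy
  simp only [Fin.le_def, Fin.lt_def] at *
  omega

/-- A block of `α` crosses a block of `τ` exactly when some arc of `α` passes over one of two
`τ`-related gaps but not over the other. Hence `krew α` is the largest admissible partition. -/
theorem interleave_nonCrossing_iff (hα : α ∈ NC n) {τ : SetPartition n} (hτ : τ ∈ NC n) :
    NonCrossing (interleave α τ) ↔ τ ≤ krew α := by
  have lt_ff : ∀ {i j : Fin n} {s : Bool}, toLex (i, s) < toLex (j, s) ↔ i < j := by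
    intro i j s; simp [Prod.Lex.toLex_lt_toLex]
  -- The point `ī` lies just after `i`: comparing `i` with `j̄` is therefore weak, comparing `ī`
  -- with `j` strict.
  have lt_ft : ∀ {i j : Fin n}, toLex (i, false) < toLex (j, true) ↔ i ≤ j := by
    intro i j; simp [Prod.Lex.toLex_lt_toLex, le_iff_lt_or_eq]
  have lt_tf : ∀ {i j : Fin n}, toLex (i, true) < toLex (j, false) ↔ i < j := by
    intro i j; simp [Prod.Lex.toLex_lt_toLex]
  constructor
  · intro h
    have hne : ∀ {x y : Fin n}, (α.part x).image (fun i => toLex (i, false)) ≠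
        (τ.part y).image (fun i => toLex (i, true)) := by
      intro x y he
      have hx : toLex (x, false) ∈ (α.part x).image (fun i => toLex (i, false)) :=
        Finset.mem_image_of_mem _ (mem_part_iff.2 (Rel.refl _ _))
      rw [he, Finset.mem_image] at hx
      obtain ⟨z, -, hz⟩ := hx
      simp at hz
    have hA : ∀ x, (α.part x).image (fun i => toLex (i, false)) ∈ interleave α τ := fun x =>
      Finset.mem_union_left _ (Finset.mem_image_of_mem _ (by simp))
    have hT : ∀ x, (τ.part x).image (fun i => toLex (i, true)) ∈ interleave α τ := fun x =>
      Finset.mem_union_right _ (Finset.mem_image_of_mem _ (by simp))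
    have mA : ∀ {x y}, Rel α x y → toLex (y, false) ∈
        (α.part x).image (fun i => toLex (i, false)) := fun hxy =>
      Finset.mem_image_of_mem _ (mem_part_iff.2 hxy)
    have mT : ∀ {x y}, Rel τ x y → toLex (y, true) ∈
        (τ.part x).image (fun i => toLex (i, true)) := fun hxy =>
      Finset.mem_image_of_mem _ (mem_part_iff.2 hxy)
    have key : ∀ i j x y, Rel τ i j → Rel α x y → x ≤ i → i < y → x ≤ j ∧ j < y := by
      intro i j x y hij hxy hxi hiy
      by_contra hcon
      rcases lt_or_ge j x with hjx | hxj
      · exact h _ (hT i) _ (hA x) hne.symm ⟨_, mT hij, _, mT (Rel.refl _ _), _, mA (Rel.refl _ _),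
          _, mA hxy, lt_tf.2 hjx, lt_ft.2 hxi, lt_tf.2 hiy⟩
      · have hyj : y ≤ j := le_of_not_gt fun hlt => hcon ⟨hxj, hlt⟩
        exact h _ (hA x) _ (hT i) hne ⟨_, mA (Rel.refl _ _), _, mA hxy, _, mT (Rel.refl _ _),
          _, mT hij, lt_ft.2 hxi, lt_tf.2 hiy, lt_ft.2 hyj⟩
    rw [le_iff_rel]
    intro i j hij
    rw [rel_krew]
    exact fun x y hxy => ⟨fun h => key i j x y hij hxy h.1 h.2,
      fun h => key j i x y hij.symm hxy h.1 h.2⟩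
  · intro h B hB C hC hne
    rw [le_iff_rel] at h
    rw [mem_NC] at hα hτ
    rw [interleave, Finset.mem_union, Finset.mem_image, Finset.mem_image] at hB hC
    rcases hB with ⟨B, hB, rfl⟩ | ⟨B, hB, rfl⟩ <;> rcases hC with ⟨C, hC, rfl⟩ | ⟨C, hC, rfl⟩ <;>
      rintro ⟨_, ha, _, hb, _, hc, _, hd, h1, h2, h3⟩ <;>
      rw [Finset.mem_image] at ha hb hc hd <;>
      obtain ⟨a, ha, rfl⟩ := ha <;> obtain ⟨b, hb, rfl⟩ := hb <;>
      obtain ⟨c, hc, rfl⟩ := hc <;> obtain ⟨d, hd, rfl⟩ := hd <;>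
      have hab := rel_of_mem hB ha hb <;> have hcd := rel_of_mem hC hc hd
    · rw [lt_ff] at h1 h2 h3
      have := hα a c b d h1 h2 h3 hab hcd
      exact hne (by rw [α.eq_of_mem_parts hB hC (mem_of_rel hB ha this) hc])
    · rw [lt_ft] at h1 h3
      rw [lt_tf] at h2
      exact absurd ((rel_krew.1 (h _ _ hcd) a b hab).1 ⟨h1, h2⟩).2 h3.not_gt
    · rw [lt_tf] at h1 h3
      rw [lt_ft] at h2
      exact absurd ((rel_krew.1 (h _ _ hab) c d hcd).2 ⟨h2, h3⟩).1 h1.not_ge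
    · rw [lt_ff] at h1 h2 h3
      have := hτ a c b d h1 h2 h3 hab hcd
      exact hne (by rw [τ.eq_of_mem_parts hB hC (mem_of_rel hB ha this) hc])

theorem isKrewerasComplement_iff (hα : α ∈ NC n) {σ : SetPartition n} :
    IsKrewerasComplement α σ ↔ σ = krew α := by
  have h : IsKrewerasComplement α (krew α) :=
    ⟨⟨krew_mem_NC α, (interleave_nonCrossing_iff hα (krew_mem_NC α)).2 le_rfl⟩,
      fun τ hτ => (interleave_nonCrossing_iff hα hτ.1).1 hτ.2⟩
  exact ⟨fun hσ => hσ.unique h, fun hσ => hσ ▸ h⟩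

theorem Kr_eq_image [DecidableEq (SetPartition n)] {S : Finset (SetPartition n)} (hS : S ⊆ NC n) :
    Kr S = S.image krew := by
  ext σ
  simp only [Kr, Finset.mem_filter, Finset.mem_univ, true_and, Finset.mem_image]
  refine exists_congr fun α => and_congr_right fun hα => ?_
  rw [isKrewerasComplement_iff (hS hα), eq_comm]

theorem val_toPerm_top {i : Fin n} (hi : (i : ℕ) + 1 < n) :
    ((toPerm (⊤ : SetPartition n) i : Fin n) : ℕ) = i + 1 := by
  have h := toPerm_of_lt (α := ⊤) (x := i) (y := ⟨i + 1, hi⟩) (Fin.lt_def.2 (by simp)) rel_top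
  simp only [Fin.lt_def, Fin.le_def] at h
  omega

theorem val_toPerm_top_last {i : Fin n} (hi : (i : ℕ) + 1 = n) :
    ((toPerm (⊤ : SetPartition n) i : Fin n) : ℕ) = 0 := by
  have h := toPerm_le (α := ⊤) (x := i) (y := ⟨0, by omega⟩) (Fin.le_def.2 (by omega)) rel_top
  simpa [Fin.le_def] using h.1

/-- The right-hand side sends the gap `i` to the gap `j` for which `α` maps `j` to `i + 1`
cyclically. By `eq_toPerm` two facts suffice: the same arcs pass over `i` and `j`, and `i < j ≤ k`
whenever `i` is related to some `k > i`. -/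
theorem toPerm_krew (hα : α ∈ NC n) :
    toPerm (krew α) = (toPerm α)⁻¹ * toPerm (⊤ : SetPartition n) := by
  rw [mem_NC] at hα
  symm
  apply eq_toPerm
  · intro i
    obtain ⟨j, hj⟩ := (toPerm α).surjective (toPerm ⊤ i)
    have hfi : ((toPerm α)⁻¹ * toPerm (⊤ : SetPartition n)) i = j := by simp [← hj]
    rw [hfi]
    have hjr := rel_toPerm α j
    rw [rel_krew]
    intro x y hxy
    -- The last gap is exceptional, because `1_n` sends the last point back to the first.
    have hv : ((toPerm α j : Fin n) : ℕ) = i + 1 ∨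
        ((toPerm α j : Fin n) : ℕ) = 0 ∧ (i : ℕ) + 1 = n := by
      rw [hj]
      by_cases hi : (i : ℕ) + 1 < n
      · exact Or.inl (val_toPerm_top hi)
      · exact Or.inr ⟨val_toPerm_top_last (by omega), by omega⟩
    -- An arc inside the block of `j` cannot separate the gaps, since `j` and its image are
    -- consecutive in the cycle. For an arc of another block, `h1` to `h4` are the four ways of
    -- separating them, each a crossing.
    by_cases hB : Rel α j x
    · have key : ∀ z, Rel α j z → (j < z → j < toPerm α j ∧ toPerm α j ≤ z) ∧
          (toPerm α j ≤ j → toPerm α j ≤ z ∧ z ≤ j) :=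
        fun z hz => ⟨fun h => toPerm_of_lt h hz, fun h => toPerm_le h hz⟩
      have hx := key x hB
      have hy := key y (hB.trans hxy)
      simp only [Fin.lt_def, Fin.le_def] at *
      omega
    · have hBt : ¬ Rel α (toPerm α j) x := fun h => hB (hjr.trans h)
      have h1 : ¬ (x < j ∧ j < y ∧ y < toPerm α j) := fun h =>
        hB (hα x j y _ h.1 h.2.1 h.2.2 hxy hjr).symm
      have h2 : ¬ (x < toPerm α j ∧ toPerm α j < y ∧ y < j) := fun h =>
        hBt (hα x _ y j h.1 h.2.1 h.2.2 hxy hjr.symm).symm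
      have h3 : ¬ (j < x ∧ x < toPerm α j ∧ toPerm α j < y) := fun h =>
        hB (hα j x _ y h.1 h.2.1 h.2.2 hjr hxy)
      have h4 : ¬ (toPerm α j < x ∧ x < j ∧ j < y) := fun h =>
        hBt (hα _ x j y h.1 h.2.1 h.2.2 hjr.symm hxy)
      have n1 : x ≠ j := by rintro rfl; exact hB (Rel.refl _ _)
      have n2 : x ≠ toPerm α j := by rintro rfl; exact hB hjr
      have n3 : y ≠ j := by rintro rfl; exact hB hxy.symm
      have n4 : y ≠ toPerm α j := by rintro rfl; exact hBt hxy.symm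
      simp only [Fin.lt_def, Fin.le_def, ne_eq, Fin.ext_iff] at *
      omega
  · intro i k hik hr
    obtain ⟨j, hj⟩ := (toPerm α).surjective (toPerm ⊤ i)
    have hfi : ((toPerm α)⁻¹ * toPerm (⊤ : SetPartition n)) i = j := by simp [← hj]
    rw [hfi]
    have hjr := rel_toPerm α j
    have hik' := Fin.lt_def.1 hik
    have hv := val_toPerm_top (i := i) (by omega)
    rw [← hj] at hv
    rw [rel_krew] at hr
    -- If `j ≤ i`, the arc from `j` to `i + 1` would pass over `i` but not over `k`. If `j > k`, the
    -- arc from `i + 1` to `j` would pass over `k` but not over `i`.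
    have h1 := hr _ _ hjr
    have h2 := hr _ _ hjr.symm
    simp only [Fin.lt_def, Fin.le_def] at *
    omega

theorem krew_injOn : Set.InjOn krew (NC n : Set (SetPartition n)) := by
  intro α hα β hβ h
  apply toPerm_injective
  have := congrArg toPerm h
  rw [toPerm_krew hα, toPerm_krew hβ] at this
  exact inv_injective (mul_right_cancel this)

end Meander

namespace Meander

/-! ### Common cuts and the meet in `Kr Int(n)` -/

section Cuts

variable {n : ℕ} {α β : SetPartition n}

/-- The partition of `[n]` into the first `i` points and the remaining ones. -/
noncomputable def splitAt (n i : ℕ) : SetPartition n := kerPartition fun x : Fin n => (x : ℕ) < i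

/-- No block of `α` meets both the first `i` points and the remaining ones. -/
def Cut (α : SetPartition n) (i : ℕ) : Prop := α ≤ splitAt n i

theorem cut_iff {i : ℕ} : Cut α i ↔ ∀ x y, Rel α x y → ((x : ℕ) < i ↔ (y : ℕ) < i) := by
  simp [Cut, splitAt, le_iff_rel]

/-- `α` and `β` have no common proper cut. -/
def Irred (α β : SetPartition n) : Prop := ∀ i, 0 < i → i < n → ¬ (Cut α i ∧ Cut β i)

theorem splitAt_mem_Intv (n i : ℕ) : splitAt n i ∈ Intv n := by
  rw [mem_Intv]
  intro x y z hxy hyz h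
  simp only [splitAt, rel_kerPartition, eq_iff_iff, Fin.le_def] at *
  omega

theorem top_mem_Intv : (⊤ : SetPartition n) ∈ Intv n :=
  mem_Intv.2 fun _ _ _ _ _ _ => rel_top

theorem krew_top : krew (⊤ : SetPartition n) = ⊥ := by
  refine le_bot_iff.1 (le_iff_rel.2 fun i j h => rel_bot.2 ?_)
  rw [rel_krew] at h
  by_contra hne
  rcases lt_or_gt_of_ne hne with hlt | hlt
  · exact absurd ((h i j rel_top).1 ⟨le_rfl, hlt⟩).2 (lt_irrefl _)
  · exact absurd ((h j i rel_top).2 ⟨le_rfl, hlt⟩).2 (lt_irrefl _)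

/-- No arc passes over the last gap, so a gap is related to it iff no arc passes over that gap
either. -/
theorem rel_krew_last {i l : Fin n} (hl : (l : ℕ) + 1 = n) :
    Rel (krew α) i l ↔ Cut α (i + 1) := by
  rw [rel_krew, cut_iff]
  constructor
  · intro h x y hxy
    have h1 := h x y hxy
    have h2 := h y x hxy.symm
    simp only [Fin.le_def, Fin.lt_def] at *
    omega
  · intro h x y hxy
    have h1 := h x y hxy
    simp only [Fin.le_def, Fin.lt_def] at *
    omega

/-- A common cut `i` puts the complement of `splitAt n i`, which relates the gap before the cut to
the last gap, below both complements. Conversely, if the complement of an interval partition `γ`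
relates two gaps, then `γ` has a cut at the earlier one, which is thus related to the last gap. This
relation passes to `krew α` and `krew β` and yields a common cut. -/
theorem isKrIntMeet_bot_iff : IsKrIntMeet (krew α) (krew β) ⊥ ↔ Irred α β := by
  classical
  rw [IsKrIntMeet, Kr_eq_image Intv_subset_NC]
  constructor
  · rintro ⟨-, h⟩ i hi hin ⟨hα, hβ⟩
    have hle : krew (splitAt n i) ≤ ⊥ :=
      h ⟨Finset.mem_image_of_mem _ (splitAt_mem_Intv n i), krew_antitone hα, krew_antitone hβ⟩
    have hr : Rel (krew (splitAt n i)) ⟨i - 1, by omega⟩ ⟨n - 1, by omega⟩ := by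
      rw [rel_krew_last (by simp; omega)]
      simp [Cut, show i - 1 + 1 = i by omega]
    have := rel_bot.1 (le_iff_rel.1 hle _ _ hr)
    rw [Fin.mk.injEq] at this
    omega
  · intro h
    refine ⟨⟨Finset.mem_image.2 ⟨⊤, top_mem_Intv, krew_top⟩, bot_le, bot_le⟩, ?_⟩
    rintro τ ⟨hτ, hτα, hτβ⟩
    obtain ⟨γ, hγ, rfl⟩ := Finset.mem_image.1 hτ
    rw [mem_Intv] at hγ
    have key : ∀ i j : Fin n, i < j → ¬ Rel (krew γ) i j := by
      intro i j hij hr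
      have hij' := Fin.lt_def.1 hij
      have hcut : Rel (krew γ) i ⟨n - 1, by omega⟩ := by
        rw [rel_krew_last (by simp; omega), cut_iff]
        -- Blocks of `γ` are intervals, so an arc over gap `i` makes `i` and `i + 1` related. The
        -- short arc between them passes over `i` but not over `j`.
        have harc : ∀ x y, Rel γ x y → x ≤ i → ¬ i < y := by
          intro x y hxy hxi hiy
          have hs : i < ⟨i + 1, by omega⟩ := Fin.lt_def.2 (by simp)
          have hsy : ⟨i + 1, by omega⟩ ≤ y := Fin.le_def.2 (by simpa using hiy)
          have hrel : Rel γ i ⟨i + 1, by omega⟩ :=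
            (hγ x i y hxi hiy.le hxy).symm.trans (hγ x _ y (hxi.trans hs.le) hsy hxy)
          have := ((rel_krew.1 hr _ _ hrel).1 ⟨le_rfl, hs⟩).2
          rw [Fin.lt_def] at this
          simp only at this
          omega
        intro x y hxy
        have h1 := harc x y hxy
        have h2 := harc y x hxy.symm
        simp only [Fin.le_def, Fin.lt_def] at *
        omega
      exact h (i + 1) (by omega) (by omega)
        ⟨(rel_krew_last (by simp; omega)).1 (le_iff_rel.1 hτα _ _ hcut),
          (rel_krew_last (by simp; omega)).1 (le_iff_rel.1 hτβ _ _ hcut)⟩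
    refine le_iff_rel.2 fun x y hxy => rel_bot.2 ?_
    by_contra hne
    rcases lt_or_gt_of_ne hne with hlt | hlt
    · exact key x y hlt hxy
    · exact key y x hlt hxy.symm

end Cuts

/-! ### Concatenation of partitions -/

section Concat

variable {k m n : ℕ}

/-- The inclusion of the first `k` points of `[n]`. -/
def inLeft (h : k + m = n) : Fin k ↪ Fin n :=
  ⟨fun i => ⟨i, by omega⟩, fun i j hij => Fin.ext (by simpa using hij)⟩

/-- The inclusion of the last `m` points of `[n]`. -/
def inRight (h : k + m = n) : Fin m ↪ Fin n :=
  ⟨fun i => ⟨k + i, by omega⟩, fun i j hij => Fin.ext (by simpa using hij)⟩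

@[simp] theorem val_inLeft (h : k + m = n) (i : Fin k) : (inLeft h i : ℕ) = i := rfl

@[simp] theorem val_inRight (h : k + m = n) (i : Fin m) : (inRight h i : ℕ) = k + i := rfl

theorem inLeft_or_inRight (h : k + m = n) (x : Fin n) :
    (∃ i, inLeft h i = x) ∨ ∃ j, inRight h j = x := by
  by_cases hx : (x : ℕ) < k
  · exact Or.inl ⟨⟨x, hx⟩, rfl⟩
  · exact Or.inr ⟨⟨x - k, by omega⟩, Fin.ext (by simp; omega)⟩

theorem inLeft_lt_inRight (h : k + m = n) (i : Fin k) (j : Fin m) : inLeft h i < inRight h j := by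
  rw [Fin.lt_def, val_inLeft, val_inRight]
  omega

theorem inLeft_lt_inLeft (h : k + m = n) {i j : Fin k} : inLeft h i < inLeft h j ↔ i < j := by
  simp only [Fin.lt_def, val_inLeft]

theorem inRight_lt_inRight (h : k + m = n) {i j : Fin m} : inRight h i < inRight h j ↔ i < j := by
  simp only [Fin.lt_def, val_inRight, Nat.add_lt_add_iff_left]

theorem inLeft_le_inLeft (h : k + m = n) {i j : Fin k} : inLeft h i ≤ inLeft h j ↔ i ≤ j := by
  simp only [Fin.le_def, val_inLeft]

theorem inRight_le_inRight (h : k + m = n) {i j : Fin m} : inRight h i ≤ inRight h j ↔ i ≤ j := by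
  simp only [Fin.le_def, val_inRight, Nat.add_le_add_iff_left]

/-- The concatenation of a partition of `[k]` and a partition of `[m]`. -/
noncomputable def concat (h : k + m = n) (α : SetPartition k) (β : SetPartition m) :
    SetPartition n :=
  kerPartition fun x : Fin n => if hx : (x : ℕ) < k then Sum.inl (α.part ⟨x, hx⟩)
    else Sum.inr (β.part ⟨x - k, by omega⟩)

variable (h : k + m = n) {α : SetPartition k} {β : SetPartition m}

theorem rel_concat_left {i j : Fin k} :
    Rel (concat h α β) (inLeft h i) (inLeft h j) ↔ Rel α i j := by
  rw [concat, rel_kerPartition]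
  simp [Rel]

theorem rel_concat_right {i j : Fin m} :
    Rel (concat h α β) (inRight h i) (inRight h j) ↔ Rel β i j := by
  rw [concat, rel_kerPartition]
  simp [Rel]

theorem not_rel_concat {i : Fin k} {j : Fin m} :
    ¬ Rel (concat h α β) (inLeft h i) (inRight h j) := by
  simp [concat]

theorem not_rel_concat' {i : Fin k} {j : Fin m} :
    ¬ Rel (concat h α β) (inRight h j) (inLeft h i) := fun hr => not_rel_concat h hr.symm

/-- The restriction of a partition to the first `k` points. -/
noncomputable def restrictLeft (γ : SetPartition n) : SetPartition k :=
  kerPartition fun i => γ.part (inLeft h i)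

/-- The restriction of a partition to the last `m` points. -/
noncomputable def restrictRight (γ : SetPartition n) : SetPartition m :=
  kerPartition fun i => γ.part (inRight h i)

theorem rel_restrictLeft {γ : SetPartition n} {i j : Fin k} :
    Rel (restrictLeft h γ) i j ↔ Rel γ (inLeft h i) (inLeft h j) := rel_kerPartition

theorem rel_restrictRight {γ : SetPartition n} {i j : Fin m} :
    Rel (restrictRight h γ) i j ↔ Rel γ (inRight h i) (inRight h j) := rel_kerPartition

theorem restrictLeft_concat : restrictLeft h (concat h α β) = α :=
  ext_rel fun _ _ => (rel_restrictLeft h).trans (rel_concat_left h)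

theorem restrictRight_concat : restrictRight h (concat h α β) = β :=
  ext_rel fun _ _ => (rel_restrictRight h).trans (rel_concat_right h)

theorem concat_restrict {γ : SetPartition n} (hγ : Cut γ k) :
    concat h (restrictLeft h γ) (restrictRight h γ) = γ := by
  rw [cut_iff] at hγ
  refine ext_rel fun x y => ?_
  rcases inLeft_or_inRight h x with ⟨i, rfl⟩ | ⟨i, rfl⟩ <;>
    rcases inLeft_or_inRight h y with ⟨j, rfl⟩ | ⟨j, rfl⟩
  · rw [rel_concat_left, rel_restrictLeft]
  · refine iff_of_false (not_rel_concat h) fun hr => ?_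
    simpa using hγ _ _ hr
  · refine iff_of_false (not_rel_concat' h) fun hr => ?_
    simpa using hγ _ _ hr
  · rw [rel_concat_right, rel_restrictRight]

theorem cut_concat_iff {i : ℕ} (hi : i ≤ k) : Cut (concat h α β) i ↔ Cut α i := by
  rw [cut_iff, cut_iff]
  constructor
  · intro hc x y hxy
    simpa using hc _ _ ((rel_concat_left h).2 hxy)
  · intro hc x y hxy
    rcases inLeft_or_inRight h x with ⟨a, rfl⟩ | ⟨a, rfl⟩ <;>
      rcases inLeft_or_inRight h y with ⟨b, rfl⟩ | ⟨b, rfl⟩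
    · simpa using hc _ _ ((rel_concat_left h).1 hxy)
    · exact absurd hxy (not_rel_concat h)
    · exact absurd hxy (not_rel_concat' h)
    · simp only [val_inRight]
      omega

theorem cut_self (α : SetPartition k) : Cut α k :=
  cut_iff.2 fun x y _ => by simp

theorem concat_mem_Intv : concat h α β ∈ Intv n ↔ α ∈ Intv k ∧ β ∈ Intv m := by
  simp only [mem_Intv]
  constructor
  · intro hc
    constructor
    · intro x y z hxy hyz hxz
      exact (rel_concat_left h).1 (hc _ _ _ ((inLeft_le_inLeft h).2 hxy)
        ((inLeft_le_inLeft h).2 hyz) ((rel_concat_left h).2 hxz))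
    · intro x y z hxy hyz hxz
      exact (rel_concat_right h).1 (hc _ _ _ ((inRight_le_inRight h).2 hxy)
        ((inRight_le_inRight h).2 hyz) ((rel_concat_right h).2 hxz))
  · rintro ⟨hα, hβ⟩ x y z hxy hyz hxz
    rcases inLeft_or_inRight h x with ⟨a, rfl⟩ | ⟨a, rfl⟩ <;>
      rcases inLeft_or_inRight h z with ⟨c, rfl⟩ | ⟨c, rfl⟩
    · rcases inLeft_or_inRight h y with ⟨b, rfl⟩ | ⟨b, rfl⟩
      · exact (rel_concat_left h).2 (hα a b c ((inLeft_le_inLeft h).1 hxy)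
          ((inLeft_le_inLeft h).1 hyz) ((rel_concat_left h).1 hxz))
      · exact absurd hyz (inLeft_lt_inRight h _ _).not_ge
    · exact absurd hxz (not_rel_concat h)
    · exact absurd hxz (not_rel_concat' h)
    · rcases inLeft_or_inRight h y with ⟨b, rfl⟩ | ⟨b, rfl⟩
      · exact absurd hxy (inLeft_lt_inRight h _ _).not_ge
      · exact (rel_concat_right h).2 (hβ a b c ((inRight_le_inRight h).1 hxy)
          ((inRight_le_inRight h).1 hyz) ((rel_concat_right h).1 hxz))

theorem concat_mem_NC : concat h α β ∈ NC n ↔ α ∈ NC k ∧ β ∈ NC m := by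
  simp only [mem_NC]
  constructor
  · intro hc
    constructor
    · intro x y z w h1 h2 h3 hxz hyw
      exact (rel_concat_left h).1 (hc _ _ _ _ ((inLeft_lt_inLeft h).2 h1)
        ((inLeft_lt_inLeft h).2 h2) ((inLeft_lt_inLeft h).2 h3) ((rel_concat_left h).2 hxz)
        ((rel_concat_left h).2 hyw))
    · intro x y z w h1 h2 h3 hxz hyw
      exact (rel_concat_right h).1 (hc _ _ _ _ ((inRight_lt_inRight h).2 h1)
        ((inRight_lt_inRight h).2 h2) ((inRight_lt_inRight h).2 h3) ((rel_concat_right h).2 hxz)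
        ((rel_concat_right h).2 hyw))
  · rintro ⟨hα, hβ⟩ x y z w h1 h2 h3 hxz hyw
    rcases inLeft_or_inRight h x with ⟨a, rfl⟩ | ⟨a, rfl⟩ <;>
      rcases inLeft_or_inRight h z with ⟨c, rfl⟩ | ⟨c, rfl⟩
    · rcases inLeft_or_inRight h y with ⟨b, rfl⟩ | ⟨b, rfl⟩
      · rcases inLeft_or_inRight h w with ⟨d, rfl⟩ | ⟨d, rfl⟩
        · exact (rel_concat_left h).2 (hα a b c d ((inLeft_lt_inLeft h).1 h1)
            ((inLeft_lt_inLeft h).1 h2) ((inLeft_lt_inLeft h).1 h3) ((rel_concat_left h).1 hxz)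
            ((rel_concat_left h).1 hyw))
        · exact absurd hyw (not_rel_concat h)
      · exact absurd h2 (inLeft_lt_inRight h _ _).not_gt
    · exact absurd hxz (not_rel_concat h)
    · exact absurd hxz (not_rel_concat' h)
    · rcases inLeft_or_inRight h y with ⟨b, rfl⟩ | ⟨b, rfl⟩
      · exact absurd h1 (inLeft_lt_inRight h _ _).not_gt
      · rcases inLeft_or_inRight h w with ⟨d, rfl⟩ | ⟨d, rfl⟩
        · exact absurd hyw (not_rel_concat' h)
        · exact (rel_concat_right h).2 (hβ a b c d ((inRight_lt_inRight h).1 h1)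
            ((inRight_lt_inRight h).1 h2) ((inRight_lt_inRight h).1 h3)
            ((rel_concat_right h).1 hxz) ((rel_concat_right h).1 hyw))

theorem concat_eq_bot : concat h α β = ⊥ ↔ α = ⊥ ∧ β = ⊥ := by
  constructor
  · intro hc
    constructor
    · refine le_bot_iff.1 (le_iff_rel.2 fun i j hij => rel_bot.2 ?_)
      have := (rel_concat_left (β := β) h).2 hij
      rw [hc, rel_bot] at this
      exact (inLeft h).injective this
    · refine le_bot_iff.1 (le_iff_rel.2 fun i j hij => rel_bot.2 ?_)
      have := (rel_concat_right (α := α) h).2 hij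
      rw [hc, rel_bot] at this
      exact (inRight h).injective this
  · rintro ⟨rfl, rfl⟩
    refine le_bot_iff.1 (le_iff_rel.2 fun x y hxy => rel_bot.2 ?_)
    rcases inLeft_or_inRight h x with ⟨a, rfl⟩ | ⟨a, rfl⟩ <;>
      rcases inLeft_or_inRight h y with ⟨b, rfl⟩ | ⟨b, rfl⟩
    · rw [rel_bot.1 ((rel_concat_left h).1 hxy)]
    · exact absurd hxy (not_rel_concat h)
    · exact absurd hxy (not_rel_concat' h)
    · rw [rel_bot.1 ((rel_concat_right h).1 hxy)]

/-- `toPerm` depends only on the order inside each block, so it commutes with an increasing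
embedding whose range is a union of blocks. -/
theorem toPerm_map {γ : SetPartition n} {f : Fin k → Fin n} (hf : ∀ {i j}, f i ≤ f j ↔ i ≤ j)
    (hrel : ∀ {i j}, Rel γ (f i) (f j) ↔ Rel α i j)
    (hrange : ∀ {i y}, Rel γ (f i) y → ∃ j, f j = y) (i : Fin k) :
    toPerm γ (f i) = f (toPerm α i) := by
  have hlt : ∀ {i j}, f i < f j ↔ i < j := by
    intro i j
    rw [← not_le, hf, not_le]
  obtain ⟨j, hj⟩ := hrange (rel_toPerm γ (f i))
  have hij : Rel α i j := hrel.1 (hj ▸ rel_toPerm γ (f i))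
  rw [← hj]
  congr 1
  rcases lt_or_ge i j with h1 | h1
  · have h2 := toPerm_of_lt h1 hij
    refine le_antisymm (hf.1 ?_) h2.2
    rw [hj]
    exact (toPerm_of_lt (hlt.2 h2.1) (hrel.2 (rel_toPerm α i))).2
  · have h2 : toPerm γ (f i) ≤ f i := hj ▸ hf.2 h1
    have h3 : toPerm α i ≤ i := hf.1 (toPerm_le h2 (hrel.2 (rel_toPerm α i))).2
    refine le_antisymm (hf.1 ?_) (toPerm_le h3 hij).1
    rw [hj]
    exact (toPerm_le h2 (hrel.2 (rel_toPerm α i))).1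

theorem exists_inLeft_of_rel {i : Fin k} {y : Fin n} (hr : Rel (concat h α β) (inLeft h i) y) :
    ∃ j, inLeft h j = y := by
  rcases inLeft_or_inRight h y with hj | ⟨j, rfl⟩
  · exact hj
  · exact absurd hr (not_rel_concat h)

theorem exists_inRight_of_rel {i : Fin m} {y : Fin n} (hr : Rel (concat h α β) (inRight h i) y) :
    ∃ j, inRight h j = y := by
  rcases inLeft_or_inRight h y with ⟨j, rfl⟩ | hj
  · exact absurd hr (not_rel_concat' h)
  · exact hj

theorem toPerm_concat_left (i : Fin k) :
    toPerm (concat h α β) (inLeft h i) = inLeft h (toPerm α i) :=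
  toPerm_map (inLeft_le_inLeft h) (rel_concat_left h) (exists_inLeft_of_rel h) i

theorem toPerm_concat_right (i : Fin m) :
    toPerm (concat h α β) (inRight h i) = inRight h (toPerm β i) :=
  toPerm_map (inRight_le_inRight h) (rel_concat_right h) (exists_inRight_of_rel h) i

theorem permLength_concat {p : Equiv.Perm (Fin k)} {q : Equiv.Perm (Fin m)}
    {r : Equiv.Perm (Fin n)} (hp : ∀ i, r (inLeft h i) = inLeft h (p i))
    (hq : ∀ j, r (inRight h j) = inRight h (q j)) :
    permLength r = permLength p + permLength q :=
  permLength_eq_add _ _ (inLeft h).injective (inRight h).injective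
    (fun i j => (inLeft_lt_inRight h i j).ne) (inLeft_or_inRight h) hp hq

theorem permLength_toPerm_concat :
    permLength (toPerm (concat h α β)) = permLength (toPerm α) + permLength (toPerm β) :=
  permLength_concat h (toPerm_concat_left h) (toPerm_concat_right h)

theorem permLength_inv_mul_concat {α' : SetPartition k} {β' : SetPartition m} :
    permLength ((toPerm (concat h α β))⁻¹ * toPerm (concat h α' β')) =
      permLength ((toPerm α)⁻¹ * toPerm α') + permLength ((toPerm β)⁻¹ * toPerm β') := by
  apply permLength_concat h
  · intro i
    rw [Equiv.Perm.mul_apply, Equiv.Perm.inv_eq_iff_eq, toPerm_concat_left, toPerm_concat_left]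
    simp
  · intro i
    rw [Equiv.Perm.mul_apply, Equiv.Perm.inv_eq_iff_eq, toPerm_concat_right, toPerm_concat_right]
    simp

theorem part_concat_left (i : Fin k) :
    (concat h α β).part (inLeft h i) = (α.part i).map (inLeft h) := by
  ext y
  rw [mem_part_iff, Finset.mem_map]
  constructor
  · intro hr
    obtain ⟨j, rfl⟩ := exists_inLeft_of_rel h hr
    exact ⟨j, mem_part_iff.2 ((rel_concat_left h).1 hr), rfl⟩
  · rintro ⟨j, hj, rfl⟩
    exact (rel_concat_left h).2 (mem_part_iff.1 hj)

theorem part_concat_right (i : Fin m) :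
    (concat h α β).part (inRight h i) = (β.part i).map (inRight h) := by
  ext y
  rw [mem_part_iff, Finset.mem_map]
  constructor
  · intro hr
    obtain ⟨j, rfl⟩ := exists_inRight_of_rel h hr
    exact ⟨j, mem_part_iff.2 ((rel_concat_right h).1 hr), rfl⟩
  · rintro ⟨j, hj, rfl⟩
    exact (rel_concat_right h).2 (mem_part_iff.1 hj)

theorem parts_concat : (concat h α β).parts =
    α.parts.image (Finset.map (inLeft h)) ∪ β.parts.image (Finset.map (inRight h)) := by
  ext B
  simp only [Finset.mem_union, Finset.mem_image, mem_parts_iff]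
  constructor
  · rintro ⟨x, rfl⟩
    rcases inLeft_or_inRight h x with ⟨i, rfl⟩ | ⟨i, rfl⟩
    · exact Or.inl ⟨_, ⟨i, rfl⟩, (part_concat_left h i).symm⟩
    · exact Or.inr ⟨_, ⟨i, rfl⟩, (part_concat_right h i).symm⟩
  · rintro (⟨_, ⟨i, rfl⟩, rfl⟩ | ⟨_, ⟨i, rfl⟩, rfl⟩)
    · exact ⟨_, part_concat_left h i⟩
    · exact ⟨_, part_concat_right h i⟩

theorem prod_parts_concat {R : Type*} [CommSemiring R] (κ : ℕ → R) :
    ∏ c ∈ (concat h α β).parts, κ c.card =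
      (∏ c ∈ α.parts, κ c.card) * ∏ c ∈ β.parts, κ c.card := by
  rw [parts_concat, Finset.prod_union, Finset.prod_image, Finset.prod_image]
  · simp only [Finset.card_map]
  · exact (Finset.map_injective _).injOn
  · exact (Finset.map_injective _).injOn
  · rw [Finset.disjoint_left]
    rintro C hC hC'
    obtain ⟨B, hB, rfl⟩ := Finset.mem_image.1 hC
    obtain ⟨B', hB', he⟩ := Finset.mem_image.1 hC'
    obtain ⟨i, hi⟩ := α.nonempty_of_mem_parts hB
    have : inLeft h i ∈ B'.map (inRight h) := he ▸ Finset.mem_map_of_mem _ hi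
    obtain ⟨j, -, hj⟩ := Finset.mem_map.1 this
    exact (inLeft_lt_inRight h i j).ne hj.symm

end Concat

end Meander

namespace Meander

/-! ### Splitting at the first common cut -/

section Recursion

open Finset

/-- The smallest positive common cut of `α` and `β` is `k`. -/
def FirstCut {n : ℕ} (α β : SetPartition n) (k : ℕ) : Prop :=
  (Cut α k ∧ Cut β k) ∧ ∀ i, 0 < i → i < k → ¬ (Cut α i ∧ Cut β i)

theorem FirstCut.eq {n : ℕ} {α β : SetPartition n} {k l : ℕ} (hk : 0 < k) (hl : 0 < l)
    (h : FirstCut α β k) (h' : FirstCut α β l) : k = l := by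
  rcases lt_trichotomy k l with hlt | heq | hlt
  · exact absurd h.1 (h'.2 k hk hlt)
  · exact heq
  · exact absurd h'.1 (h.2 l hl hlt)

theorem exists_firstCut {n : ℕ} (hn : 0 < n) (α β : SetPartition n) :
    ∃ k, 0 < k ∧ k ≤ n ∧ FirstCut α β k := by
  classical
  have hex : ∃ i, 0 < i ∧ Cut α i ∧ Cut β i := ⟨n, hn, cut_self α, cut_self β⟩
  exact ⟨Nat.find hex, (Nat.find_spec hex).1, Nat.find_min' hex ⟨hn, cut_self α, cut_self β⟩,
    (Nat.find_spec hex).2, fun i hi hlt hc => Nat.find_min hex hlt ⟨hi, hc⟩⟩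

/-- Up to `k` the cuts of a concatenation are those of its left factor, so the right factors are
unconstrained. -/
theorem firstCut_concat {k m n : ℕ} (h : k + m = n) {α β : SetPartition k}
    {α' β' : SetPartition m} : FirstCut (concat h α α') (concat h β β') k ↔ Irred α β := by
  rw [FirstCut, cut_concat_iff h le_rfl, cut_concat_iff h le_rfl,
    and_iff_right ⟨cut_self α, cut_self β⟩, Irred]
  refine forall_congr' fun i => forall_congr' fun _ => forall_congr' fun hik => ?_
  rw [cut_concat_iff h hik.le, cut_concat_iff h hik.le]

variable {R : Type*} [CommSemiring R] (L : (n : ℕ) → Finset (SetPartition n))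
  (w : (n : ℕ) → SetPartition n → SetPartition n → R)

/-- The sum of the weights of all pairs in `Int(n) × L(n)`. -/
noncomputable def pairSum (n : ℕ) : R := ∑ p ∈ Intv n ×ˢ L n, w n p.1 p.2

open Classical in
/-- The sum of the weights of the pairs in `Int(n) × L(n)` without common proper cut. -/
noncomputable def irredSum (n : ℕ) : R :=
  ∑ p ∈ Intv n ×ˢ L n with Irred p.1 p.2, w n p.1 p.2

variable {L w}

open Classical in
theorem sum_firstCut
    (hL : ∀ {k m n : ℕ} (h : k + m = n) (α : SetPartition k) (β : SetPartition m),
      concat h α β ∈ L n ↔ α ∈ L k ∧ β ∈ L m)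
    (hw : ∀ {k m n : ℕ} (h : k + m = n) (α β : SetPartition k) (α' β' : SetPartition m),
      w n (concat h α α') (concat h β β') = w k α β * w m α' β')
    {k m n : ℕ} (h : k + m = n) :
    ∑ p ∈ Intv n ×ˢ L n with FirstCut p.1 p.2 k, w n p.1 p.2 = irredSum L w k * pairSum L w m := by
  rw [irredSum, pairSum, sum_mul_sum, ← sum_product']
  symm
  refine sum_bij' (fun q _ => (concat h q.1.1 q.2.1, concat h q.1.2 q.2.2))
    (fun p _ => ((restrictLeft h p.1, restrictLeft h p.2),
      (restrictRight h p.1, restrictRight h p.2))) ?_ ?_ ?_ ?_ ?_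
  · rintro ⟨⟨α, β⟩, α', β'⟩ hq
    simp only [mem_product, mem_filter] at hq
    simp only [mem_product, mem_filter]
    exact ⟨⟨(concat_mem_Intv h).2 ⟨hq.1.1.1, hq.2.1⟩, (hL h _ _).2 ⟨hq.1.1.2, hq.2.2⟩⟩,
      (firstCut_concat h).2 hq.1.2⟩
  · rintro ⟨γ, δ⟩ hp
    simp only [mem_product, mem_filter] at hp
    simp only [mem_product, mem_filter]
    obtain ⟨⟨hγ, hδ⟩, hc⟩ := hp
    rw [← concat_restrict h hc.1.1] at hγ
    rw [← concat_restrict h hc.1.2] at hδ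
    have hc' := hc
    rw [← concat_restrict h hc.1.1, ← concat_restrict h hc.1.2, firstCut_concat] at hc'
    rw [concat_mem_Intv] at hγ
    rw [hL] at hδ
    exact ⟨⟨⟨hγ.1, hδ.1⟩, hc'⟩, hγ.2, hδ.2⟩
  · rintro ⟨⟨α, β⟩, α', β'⟩ -
    simp only [restrictLeft_concat, restrictRight_concat]
  · rintro ⟨γ, δ⟩ hp
    have hc := (mem_filter.1 hp).2
    simp only [concat_restrict h hc.1.1, concat_restrict h hc.1.2]
  · rintro ⟨⟨α, β⟩, α', β'⟩ -
    exact (hw h α β α' β').symm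

/-- For `n > 0` every pair has exactly one first common cut, `n` itself being always a cut. Sorting
the pairs by it gives the recursion. -/
theorem pairSum_eq_sum
    (hL : ∀ {k m n : ℕ} (h : k + m = n) (α : SetPartition k) (β : SetPartition m),
      concat h α β ∈ L n ↔ α ∈ L k ∧ β ∈ L m)
    (hw : ∀ {k m n : ℕ} (h : k + m = n) (α β : SetPartition k) (α' β' : SetPartition m),
      w n (concat h α α') (concat h β β') = w k α β * w m α' β')
    {n : ℕ} (hn : 0 < n) :
    pairSum L w n = ∑ d ∈ antidiagonal n with 0 < d.1, irredSum L w d.1 * pairSum L w d.2 := by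
  classical
  have hs : ∀ d ∈ (antidiagonal n).filter (fun d => 0 < d.1),
      irredSum L w d.1 * pairSum L w d.2 =
        ∑ p ∈ Intv n ×ˢ L n, if FirstCut p.1 p.2 d.1 then w n p.1 p.2 else 0 := by
    intro d hd
    rw [mem_filter, HasAntidiagonal.mem_antidiagonal] at hd
    rw [← sum_firstCut hL hw hd.1, sum_filter]
  rw [sum_congr rfl hs, sum_comm, pairSum]
  refine sum_congr rfl fun p _ => ?_
  obtain ⟨k, hk, hkn, hc⟩ := exists_firstCut hn p.1 p.2
  rw [sum_eq_single (k, n - k), if_pos hc]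
  · rintro ⟨a, b⟩ hd hne
    rw [mem_filter, HasAntidiagonal.mem_antidiagonal] at hd
    refine if_neg fun hc' => hne ?_
    obtain rfl : a = k := hc'.eq hd.2 hk hc
    simp only at hd
    rw [Prod.mk.injEq]
    omega
  · intro hd
    refine absurd ?_ hd
    rw [mem_filter, HasAntidiagonal.mem_antidiagonal]
    simp only
    omega

theorem eq_of_recursion {a b κ κ' : ℕ → R} (h0 : a 0 = b 0) (hκ : ∀ k, 0 < k → κ k = κ' k)
    (ha : ∀ n, 0 < n → a n = ∑ d ∈ antidiagonal n with 0 < d.1, κ d.1 * a d.2)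
    (hb : ∀ n, 0 < n → b n = ∑ d ∈ antidiagonal n with 0 < d.1, κ' d.1 * b d.2) (n : ℕ) :
    a n = b n := by
  induction n using Nat.strong_induction_on with
  | _ n ih =>
    rcases Nat.eq_zero_or_pos n with rfl | hn
    · exact h0
    rw [ha n hn, hb n hn]
    refine sum_congr rfl fun d hd => ?_
    rw [mem_filter, HasAntidiagonal.mem_antidiagonal] at hd
    rw [hκ d.1 hd.2, ih d.2 (by omega)]

end Recursion

/-! ### The boolean transform and the weights -/

section Transform

variable {R : Type*} [CommSemiring R]

/-- The constant second partition `⊥` is cut everywhere, so the common cuts are those of `σ`, and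
the first-cut recursion covers the boolean transform as well. -/
theorem booleSeq_eq_pairSum (κ : ℕ → R) (n : ℕ) :
    booleSeq κ n = pairSum (fun _ => {⊥}) (fun _ σ _ => ∏ c ∈ σ.parts, κ c.card) n := by
  rw [booleSeq, pairSum, Finset.sum_product]
  simp

theorem cut_bot {n : ℕ} (i : ℕ) : Cut (⊥ : SetPartition n) i := bot_le

/-- In an interval partition, if `i` and `i + 1` lie in different blocks then there is a cut between
them. Without proper cuts all neighbours are related. -/
theorem irred_bot_iff {n : ℕ} {σ : SetPartition n} (hσ : σ ∈ Intv n) : Irred σ ⊥ ↔ σ = ⊤ := by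
  rw [mem_Intv] at hσ
  constructor
  · intro h
    have hsucc : ∀ (i : ℕ) (hi : i + 1 < n), Rel σ ⟨i, by omega⟩ ⟨i + 1, hi⟩ := by
      intro i hi
      by_contra hr
      refine h (i + 1) (by omega) hi ⟨cut_iff.2 ?_, cut_bot _⟩
      have key : ∀ x y, Rel σ x y → (x : ℕ) < i + 1 → (y : ℕ) < i + 1 := by
        intro x y hxy hx
        by_contra hy
        have hix : x ≤ ⟨i, by omega⟩ := Fin.le_def.2 (by simp; omega)
        have hiy : ⟨i + 1, hi⟩ ≤ y := Fin.le_def.2 (by simp; omega)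
        have hii : (⟨i, by omega⟩ : Fin n) ≤ ⟨i + 1, hi⟩ := Fin.le_def.2 (by simp)
        exact hr ((hσ x _ y hix (hii.trans hiy) hxy).symm.trans
          (hσ x _ y (hix.trans hii) hiy hxy))
      exact fun x y hxy => ⟨key x y hxy, key y x hxy.symm⟩
    have hzero : ∀ (i : ℕ) (hi : i < n), Rel σ ⟨0, by omega⟩ ⟨i, hi⟩ := by
      intro i
      induction i with
      | zero => exact fun _ => Rel.refl _ _
      | succ i ih => exact fun hi => (ih (by omega)).trans (hsucc i hi)
    exact ext_rel fun x y => ⟨fun _ => rel_top, fun _ => (hzero x x.2).symm.trans (hzero y y.2)⟩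
  · rintro rfl i hi hin ⟨hc, -⟩
    have := (cut_iff.1 hc ⟨0, by omega⟩ ⟨i, hin⟩ rel_top).1 hi
    simp at this

theorem parts_top {n : ℕ} (hn : 0 < n) : (⊤ : SetPartition n).parts = {Finset.univ} := by
  ext B
  rw [mem_parts_iff, Finset.mem_singleton]
  have hp : ∀ x, (⊤ : SetPartition n).part x = Finset.univ := fun x =>
    Finset.eq_univ_of_forall fun y => mem_part_iff.2 rel_top
  simp only [hp]
  exact ⟨fun ⟨_, h⟩ => h.symm, fun h => ⟨⟨0, hn⟩, h.symm⟩⟩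

theorem irredSum_bot (κ : ℕ → R) {n : ℕ} (hn : 0 < n) :
    irredSum (fun _ => {⊥}) (fun _ σ _ => ∏ c ∈ σ.parts, κ c.card) n = κ n := by
  classical
  have hs : (Intv n ×ˢ {⊥}).filter (fun p : SetPartition n × SetPartition n => Irred p.1 p.2) =
      {(⊤, ⊥)} := by
    ext ⟨σ, τ⟩
    simp only [Finset.mem_filter, Finset.mem_product, Finset.mem_singleton, Prod.mk.injEq]
    constructor
    · rintro ⟨⟨hσ, rfl⟩, h⟩
      exact ⟨(irred_bot_iff hσ).1 h, rfl⟩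
    · rintro ⟨rfl, rfl⟩
      exact ⟨⟨top_mem_Intv, rfl⟩, (irred_bot_iff top_mem_Intv).2 rfl⟩
  have h : irredSum (fun _ => {⊥}) (fun _ σ _ => ∏ c ∈ σ.parts, κ c.card) n =
      ∑ p ∈ (Intv n ×ˢ {⊥}).filter (fun p : SetPartition n × SetPartition n => Irred p.1 p.2),
        ∏ c ∈ p.1.parts, κ c.card := by
    rw [irredSum]
  rw [h, hs, Finset.sum_singleton, parts_top hn, Finset.prod_singleton, Finset.card_univ,
    Fintype.card_fin]

variable (Y A B : R)

/-- The weight of a pair of partitions. -/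
noncomputable def weight (n : ℕ) (α β : SetPartition n) : R :=
  Y ^ permLength ((toPerm α)⁻¹ * toPerm β) * A ^ permLength (toPerm α) * B ^ permLength (toPerm β)

theorem weight_concat {k m n : ℕ} (h : k + m = n) (α β : SetPartition k) (α' β' : SetPartition m) :
    weight Y A B n (concat h α α') (concat h β β') =
      weight Y A B k α β * weight Y A B m α' β' := by
  simp only [weight, permLength_inv_mul_concat, permLength_toPerm_concat, pow_add]
  ring

theorem moment_eq_pairSum (L : (n : ℕ) → Finset (SetPartition n)) (n : ℕ) :
    moment L Y A B n = pairSum L (weight Y A B) n := by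
  rw [pairSum, Finset.sum_product]
  rfl

/-- With `c = 1_n`, the permutation on the left is `c⁻¹ α β⁻¹ c`. It is conjugate to `β⁻¹ α`, the
inverse of `α⁻¹ β`. -/
theorem permLength_krew_inv_mul_krew {n : ℕ} {α β : SetPartition n} (hα : α ∈ NC n)
    (hβ : β ∈ NC n) : permLength ((toPerm (krew α))⁻¹ * toPerm (krew β)) =
      permLength ((toPerm α)⁻¹ * toPerm β) := by
  rw [toPerm_krew hα, toPerm_krew hβ]
  set c := toPerm (⊤ : SetPartition n)
  calc permLength (((toPerm α)⁻¹ * c)⁻¹ * ((toPerm β)⁻¹ * c))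
      = permLength (c⁻¹ * (toPerm α * (toPerm β)⁻¹) * c⁻¹⁻¹) := by simp [mul_assoc]
    _ = permLength ((toPerm α)⁻¹ * (toPerm α * (toPerm β)⁻¹) * (toPerm α)⁻¹⁻¹) := by
      rw [permLength_conj, permLength_conj]
    _ = permLength ((toPerm α)⁻¹ * toPerm β)⁻¹ := by simp
    _ = _ := permLength_inv _

theorem permLength_krew_inv_mul_top {n : ℕ} {α : SetPartition n} (hα : α ∈ NC n) :
    permLength ((toPerm (krew α))⁻¹ * toPerm (⊤ : SetPartition n)) = permLength (toPerm α) := by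
  rw [toPerm_krew hα]
  set c := toPerm (⊤ : SetPartition n)
  calc permLength (((toPerm α)⁻¹ * c)⁻¹ * c) = permLength (c⁻¹ * toPerm α * c⁻¹⁻¹) := by
        simp [mul_assoc]
    _ = _ := permLength_conj _ _

/-- Both sums are reindexed along `krew`, which is injective on `NC n`. The meet condition becomes
irreducibility and the exponents match. -/
theorem cumulant_eq_irredSum {L : (n : ℕ) → Finset (SetPartition n)} {n : ℕ} (hL : L n ⊆ NC n) :
    cumulant L Y A B n = irredSum L (weight Y A B) n := by
  classical
  rw [irredSum, Finset.sum_filter, Finset.sum_product, cumulant, Kr_eq_image Intv_subset_NC,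
    Kr_eq_image hL, Finset.sum_image (krew_injOn.mono (Finset.coe_subset.2 Intv_subset_NC))]
  refine Finset.sum_congr rfl fun α hα => ?_
  rw [Finset.sum_filter, Finset.sum_image (krew_injOn.mono (Finset.coe_subset.2 hL))]
  refine Finset.sum_congr rfl fun β hβ => ?_
  have hα' := Intv_subset_NC hα
  have hβ' := hL hβ
  simp only [isKrIntMeet_bot_iff, permLength_krew_inv_mul_krew hα' hβ',
    permLength_krew_inv_mul_top hα', permLength_krew_inv_mul_top hβ', weight]

/-- `NC` and `Intv` enter only through these hypotheses: being non-crossing, and being stable under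
concatenation and under splitting. -/
theorem boole_cumulantSeries {L : (n : ℕ) → Finset (SetPartition n)} (hNC : ∀ n, L n ⊆ NC n)
    (h0 : ⊥ ∈ L 0)
    (hL : ∀ {k m n : ℕ} (h : k + m = n) (α : SetPartition k) (β : SetPartition m),
      concat h α β ∈ L n ↔ α ∈ L k ∧ β ∈ L m) :
    boole (cumulantSeries L Y A B) = momentSeries L Y A B := by
  rw [boole, momentSeries]
  congr 1
  funext n
  rw [booleSeq_eq_pairSum, moment_eq_pairSum]
  have hsub : ∀ α : SetPartition 0, α = ⊥ := fun α => ext_rel fun x => x.elim0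
  refine eq_of_recursion ?_ ?_ (fun n hn => pairSum_eq_sum ?_ ?_ hn)
    (fun n hn => pairSum_eq_sum hL (weight_concat Y A B) hn) n
  -- The recursions start at `n = 0`, where both sums consist of the empty partition with weight
  -- `1`.
  · have hI : Intv 0 = {⊥} := by
      ext α
      simp [hsub α, mem_Intv]
    have hL0 : L 0 = {⊥} := by
      ext α
      simp [hsub α, h0]
    have h1 : ∀ π : Equiv.Perm (Fin 0), permLength π = 0 := by
      intro π
      rw [permLength_eq_finrank, Subsingleton.elim π 1, moveSpan_one, finrank_bot]
    simp [pairSum, hI, hL0, weight, h1]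
  · intro k hk
    rw [irredSum_bot (fun k => PowerSeries.coeff k (cumulantSeries L Y A B)) hk,
      ← cumulant_eq_irredSum Y A B (hNC k)]
    simp [cumulantSeries, genSeries, hk.ne']
  · intro k m n h α β
    simpa only [Finset.mem_singleton] using concat_eq_bot h
  · intro k m n h α β α' β'
    exact prod_parts_concat h fun k => PowerSeries.coeff k (cumulantSeries L Y A B)

end Transform

end Meander

/-- The ring `R` of coefficients is arbitrary; for `R = ℤ[Y, A, B]` and its three variables this is
the identity of formal generating series. -/
theorem theorem3p8 {R : Type*} [CommSemiring R] (Y A B : R) :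
    Meander.boole (Meander.cumulantSeries Meander.NC Y A B) =
        Meander.momentSeries Meander.NC Y A B ∧
      Meander.boole (Meander.cumulantSeries Meander.Intv Y A B) =
        Meander.momentSeries Meander.Intv Y A B :=
  ⟨Meander.boole_cumulantSeries Y A B (fun _ => subset_rfl)
    (Meander.mem_NC.2 fun a => a.elim0) fun h _ _ => Meander.concat_mem_NC h,
  Meander.boole_cumulantSeries Y A B (fun _ => Meander.Intv_subset_NC)
    (Meander.mem_Intv.2 fun a => a.elim0) fun h _ _ => Meander.concat_mem_Intv h⟩
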